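/- Let $\omega>0$, $\theta, x_0, v_0\in\mathbb{R}$ be fixed (independent of $\epsilon$), and for $\epsilon>0$ let $x(t)$, $t\ge 0$, be the solution of $$\ddot{x}+\omega^2\bigl(1+\epsilon\cos(2\omega t+\theta)\bigr)x=0,\qquad x(0)=x_0,\quad \dot{x}(0)=v_0 .$$ Suppose that $$\tan\frac{\theta}{2}=\frac{x_0-v_0/\omega}{x_0+v_0/\omega},$$ where the condition means that both sides are defined and equal, or that both denominators vanish, i.e. $\cos(\theta/2)=0$ and $x_0+v_0/\omega=0$. Then $$x(t)=e^{-\epsilon\omega t/4}\Bigl(x_0\cos\omega t+\frac{v_0}{\omega}\sin\omega t\Bigr)+\mathcal{O}(\epsilon)$$ uniformly for times of order $\epsilon^{-1}$: for every $K>0$ there are constants $C>0$ and $\epsilon_0>0$, independent of $\epsilon$ and $t$, such that for all $0<\epsilon<\epsilon_0$ and all $0\le t\le K/\epsilon$, $$\Bigl|x(t)-e^{-\epsilon\omega t/4}\Bigl(x_0\cos\omega t+\frac{v_0}{\omega}\sin\omega t\Bigr)\Bigr|\le C\epsilon .$$ -/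

import Mathlib

/-- The function `x` solves the initial value problem
`x'' + ω² (1 + ε cos (2ωt + θ)) x = 0`, `x 0 = x₀`, `x' 0 = v₀` for all times `t ≥ 0`;
the function `v` below is the velocity `x'` (one-sided derivatives are used at `t = 0`). -/
def IsPhaseMathieuSolution (ω ε θ x₀ v₀ : ℝ) (x : ℝ → ℝ) : Prop :=
  ∃ v : ℝ → ℝ, x 0 = x₀ ∧ v 0 = v₀ ∧
    ∀ t : ℝ, 0 ≤ t →
      HasDerivWithinAt x (v t) (Set.Ici 0) t ∧
      HasDerivWithinAt v (-(ω ^ 2 * (1 + ε * Real.cos (2 * ω * t + θ)) * x t)) (Set.Ici 0) t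

/-- The equation `tan (θ / 2) = p / q`, read in the extended sense: either both sides are
well-defined real numbers and agree, or both denominators `cos (θ / 2)` and `q` vanish. -/
def TanHalfEqRatio (θ p q : ℝ) : Prop :=
  (Real.cos (θ / 2) ≠ 0 ∧ q ≠ 0 ∧ Real.tan (θ / 2) = p / q) ∨
    (Real.cos (θ / 2) = 0 ∧ q = 0)

/-! The condition on `θ` puts `(x₀, v₀/ω)` on the fixed line of a reflection, the decaying direction
of the averaged flow. There the resonant part of the forcing is exactly cancelled by the damping of
`e^{-εωt/4}`, leaving only a third harmonic. An `O(ε)` correction removes that harmonic, so the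
residual is `O(ε²)`. The energy of the error grows at rate at most `(ω+1)ε`, hence by a bounded
factor up to time `K/ε`. -/

open Real Set in
/-- Energy estimate for the forced, parametrically perturbed oscillator
`d'' + ω² (1 + ε c(t)) d = r(t)` with `|c| ≤ 1` and `|r| ≤ ε² R`. -/
theorem perturbed_oscillator_energy_le {ω ε R : ℝ} (hω : 0 < ω) (hε : 0 < ε)
    {d p c r : ℝ → ℝ} (hc : ∀ t, |c t| ≤ 1) (hr : ∀ t, 0 ≤ t → |r t| ≤ ε ^ 2 * R)
    (hd : ∀ t, 0 ≤ t → HasDerivWithinAt d (p t) (Ici 0) t)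
    (hp : ∀ t, 0 ≤ t →
      HasDerivWithinAt p (-(ω ^ 2 * (1 + ε * c t) * d t) + r t) (Ici 0) t)
    {t : ℝ} (ht : 0 ≤ t) :
    (ω * d t) ^ 2 + p t ^ 2 ≤
      exp ((ω + 1) * ε * t) * ((ω * d 0) ^ 2 + p 0 ^ 2 + ε ^ 2 * R ^ 2) := by
  set k : ℝ := (ω + 1) * ε with hk
  -- The added `ε²R²` lets the factor `e^{-ks}` absorb the forcing as well as the parametric term.
  let F : ℝ → ℝ := fun s => exp (-(k * s)) * ((ω * d s) ^ 2 + p s ^ 2 + ε ^ 2 * R ^ 2)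
  have hF : ∀ s, 0 ≤ s → HasDerivWithinAt F
      (exp (-(k * s)) * (-k * ((ω * d s) ^ 2 + p s ^ 2 + ε ^ 2 * R ^ 2)
        + 2 * p s * (-(ω ^ 2 * ε * c s * d s) + r s))) (Ici 0) s := by
    intro s hs
    have h1 : HasDerivWithinAt (fun s => exp (-(k * s))) (exp (-(k * s)) * (-(k * 1))) (Ici 0) s :=
      (((hasDerivAt_id s).const_mul k).neg.exp).hasDerivWithinAt
    have h2 := ((((hd s hs).const_mul ω).pow 2).add ((hp s hs).pow 2)).add_const (ε ^ 2 * R ^ 2)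
    refine (h1.mul h2).congr_deriv ?_
    simp only [Pi.add_apply, Pi.pow_apply]
    push_cast
    ring
  have hanti : AntitoneOn F (Ici 0) := by
    refine antitoneOn_of_hasDerivWithinAt_nonpos (convex_Ici 0)
      (fun s hs => (hF s hs).continuousWithinAt)
      (fun s hs => (hF s (interior_subset hs)).mono interior_subset) ?_
    intro s hs
    have hs0 : 0 ≤ s := interior_subset hs
    refine mul_nonpos_of_nonneg_of_nonpos (exp_pos _).le ?_
    have hpar : -(2 * (ω * d s) * p s * c s) ≤ (ω * d s) ^ 2 + p s ^ 2 := by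
      obtain ⟨h1, h2⟩ := abs_le.1 (hc s)
      nlinarith [mul_nonneg (sub_nonneg.2 h2) (sq_nonneg (ω * d s - p s)),
        mul_nonneg (by linarith : (0 : ℝ) ≤ 1 + c s) (sq_nonneg (ω * d s + p s))]
    have hforce : 2 * p s * r s ≤ ε * (p s ^ 2 + ε ^ 2 * R ^ 2) := by
      have h1 : 2 * p s * r s ≤ 2 * |p s| * (ε ^ 2 * R) := by
        calc 2 * p s * r s ≤ |2 * p s * r s| := le_abs_self _
          _ = 2 * |p s| * |r s| := by rw [abs_mul, abs_mul, abs_two]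
          _ ≤ _ := mul_le_mul_of_nonneg_left (hr s hs0) (by positivity)
      have h2 : 2 * |p s| * (ε * R) ≤ p s ^ 2 + ε ^ 2 * R ^ 2 := by
        nlinarith [sq_nonneg (|p s| - ε * R), sq_abs (p s)]
      nlinarith [mul_le_mul_of_nonneg_left h2 hε.le]
    have h3 := mul_le_mul_of_nonneg_left hpar (mul_pos hω hε).le
    have h4 : 0 ≤ ε * (ω * d s) ^ 2 := by positivity
    have h5 : 0 ≤ ω * ε * (ε ^ 2 * R ^ 2) := by positivity
    rw [hk]
    linarith
  have h := hanti (mem_Ici.2 le_rfl) (mem_Ici.2 ht) ht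
  simp only [F, mul_zero, neg_zero, exp_zero, one_mul] at h
  rw [exp_neg, inv_mul_le_iff₀ (exp_pos _)] at h
  nlinarith [sq_nonneg (ε * R)]

-- Clearing denominators merges both cases into one linear relation in half angles; double-angle
-- formulas turn it into the eigenvector equations for eigenvalue 1.
open Real in
theorem TanHalfEqRatio.reflection_fixed {θ a b : ℝ} (h : TanHalfEqRatio θ (a - b) (a + b)) :
    a * sin θ + b * cos θ = a ∧ a * cos θ - b * sin θ = b := by
  have key : sin (θ / 2) * (a + b) = cos (θ / 2) * (a - b) := by
    rcases h with ⟨hc, hq, h⟩ | ⟨hc, hq⟩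
    · rw [tan_eq_sin_div_cos, div_eq_div_iff hc hq] at h
      linarith
    · rw [hc, hq]
      ring
  have hs : sin θ = 2 * sin (θ / 2) * cos (θ / 2) := by
    rw [← sin_two_mul, mul_div_cancel₀ θ two_ne_zero]
  have hc : cos θ = cos (θ / 2) ^ 2 - sin (θ / 2) ^ 2 := by
    rw [← cos_two_mul', mul_div_cancel₀ θ two_ne_zero]
  have h1 := sin_sq_add_cos_sq (θ / 2)
  rw [hs, hc]
  constructor
  · linear_combination (cos (θ / 2) - sin (θ / 2)) * key + a * h1
  · linear_combination -(cos (θ / 2) + sin (θ / 2)) * key + b * h1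

open Real in
/-- The resonant part of the parametric forcing of a fixed direction is its damping term. -/
theorem cos_two_mul_add_mul_eq {θ a b : ℝ} (h₁ : a * sin θ + b * cos θ = a)
    (h₂ : a * cos θ - b * sin θ = b) (τ : ℝ) :
    cos (2 * τ + θ) * (a * cos τ + b * sin τ) =
      (a * cos (3 * τ + θ) + b * sin (3 * τ + θ)) / 2 + (b * cos τ - a * sin τ) / 2 := by
  have e : b * cos τ - a * sin τ = a * cos (2 * τ + θ - τ) - b * sin (2 * τ + θ - τ) := by
    rw [show 2 * τ + θ - τ = τ + θ by ring, cos_add, sin_add]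
    linear_combination (-cos τ) * h₂ + sin τ * h₁
  rw [e, show 3 * τ + θ = 2 * τ + θ + τ by ring]
  generalize 2 * τ + θ = A
  rw [cos_add, sin_add, cos_sub, sin_sub]
  ring

open Real in
theorem abs_mul_cos_add_mul_sin_le (a b τ : ℝ) : |a * cos τ + b * sin τ| ≤ |a| + |b| := by
  refine (abs_add_le _ _).trans (add_le_add ?_ ?_) <;> rw [abs_mul]
  · exact mul_le_of_le_one_right (abs_nonneg _) (abs_cos_le_one _)
  · exact mul_le_of_le_one_right (abs_nonneg _) (abs_sin_le_one _)

open Real in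
theorem hasDerivAt_mul_cos_add_mul_sin (a b ω φ t : ℝ) :
    HasDerivAt (fun t => a * cos (ω * t + φ) + b * sin (ω * t + φ))
      (ω * (b * cos (ω * t + φ) + -a * sin (ω * t + φ))) t := by
  have h : HasDerivAt (fun t => ω * t + φ) (ω * 1) t :=
    ((hasDerivAt_id t).const_mul ω).add_const φ
  refine ((h.cos.const_mul a).add (h.sin.const_mul b)).congr_deriv ?_
  ring

set_option maxHeartbeats 1000000 in
open Real Set in
/-- For initial data on the decaying direction, the solution stays close to the second-order
approximation `e^{-εωt/4} (u + ε w / 16)`, where `w` is the third harmonic response. -/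
theorem IsPhaseMathieuSolution.abs_sub_le {ω ε θ a b : ℝ} (hω : 0 < ω) (hε : 0 < ε) (hε1 : ε < 1)
    (h₁ : a * sin θ + b * cos θ = a) (h₂ : a * cos θ - b * sin θ = b) {x : ℝ → ℝ}
    (hx : IsPhaseMathieuSolution ω ε θ a (ω * b) x) {t : ℝ} (ht : 0 ≤ t) :
    |x t - exp (-(ε * ω * t / 4)) * (a * cos (ω * t) + b * sin (ω * t))| ≤
      (√(exp ((ω + 1) * ε * t) * (2 + ω ^ 2)) + 1) * (|a| + |b|) * ε := by
  obtain ⟨v, hx0, hv0, hder⟩ := hx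
  set M : ℝ := |a| + |b| with hM
  have hM0 : 0 ≤ M := by positivity
  let u : ℝ → ℝ := fun t => a * cos (ω * t) + b * sin (ω * t)
  let u' : ℝ → ℝ := fun t => b * cos (ω * t) + -a * sin (ω * t)
  let w : ℝ → ℝ := fun t => a * cos (3 * ω * t + θ) + b * sin (3 * ω * t + θ)
  let w' : ℝ → ℝ := fun t => b * cos (3 * ω * t + θ) + -a * sin (3 * ω * t + θ)
  let g : ℝ → ℝ := fun t => exp (-(ε * ω * t / 4))
  let c : ℝ → ℝ := fun t => cos (2 * ω * t + θ)
  -- The 1/16 solves `(ω² - 9ω²)/16 = -ω²/2`, cancelling the third harmonic at order `ε`.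
  let y : ℝ → ℝ := fun t => g t * (u t + ε / 16 * w t)
  let y' : ℝ → ℝ := fun t =>
    g t * (ω * (u' t + 3 * ε / 16 * w' t) - ε * ω / 4 * (u t + ε / 16 * w t))
  let r : ℝ → ℝ := fun t =>
    -(ε ^ 2 * (g t * (ω ^ 2 / 16 * (u t + ε / 16 * w t) - 3 * ω ^ 2 / 32 * w' t
      + ω ^ 2 / 16 * c t * w t)))
  have hu s : HasDerivAt u (ω * u' s) s := by
    simpa [u, u'] using hasDerivAt_mul_cos_add_mul_sin a b ω 0 s
  have hu' s : HasDerivAt u' (-(ω * u s)) s := by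
    have := hasDerivAt_mul_cos_add_mul_sin b (-a) ω 0 s
    simp only [add_zero] at this
    exact this.congr_deriv (by simp only [u]; ring)
  have hw s : HasDerivAt w (3 * ω * w' s) s := hasDerivAt_mul_cos_add_mul_sin a b (3 * ω) θ s
  have hw' s : HasDerivAt w' (-(3 * ω * w s)) s :=
    (hasDerivAt_mul_cos_add_mul_sin b (-a) (3 * ω) θ s).congr_deriv (by simp only [w]; ring)
  have hg s : HasDerivAt g (-(ε * ω / 4) * g s) s := by
    have h : HasDerivAt (fun t => -(ε * ω * t / 4)) (-(ε * ω * 1 / 4)) s :=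
      (((hasDerivAt_id s).const_mul (ε * ω)).div_const 4).neg
    exact h.exp.congr_deriv (by simp only [g]; ring)
  have hy s : HasDerivAt y (y' s) s :=
    ((hg s).mul ((hu s).add ((hw s).const_mul (ε / 16)))).congr_deriv
      (by simp only [y', Pi.add_apply]; ring)
  have hres s : c s * u s = w s / 2 + u' s / 2 := by
    have := cos_two_mul_add_mul_eq h₁ h₂ (ω * s)
    simp only [← mul_assoc] at this
    simp only [c, u, w, u']
    linarith
  have hy' s : HasDerivAt y' (-(ω ^ 2 * (1 + ε * c s) * y s) - r s) s := by
    refine ((hg s).mul ((((hu' s).add ((hw' s).const_mul (3 * ε / 16))).const_mul ω).sub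
      (((hu s).add ((hw s).const_mul (ε / 16))).const_mul (ε * ω / 4)))).congr_deriv ?_
    simp only [y, r, Pi.add_apply, Pi.sub_apply]
    linear_combination (ω ^ 2 * ε * g s) * hres s
  have bu s : |u s| ≤ M := abs_mul_cos_add_mul_sin_le a b _
  have bw s : |w s| ≤ M := abs_mul_cos_add_mul_sin_le a b _
  have bw' s : |w' s| ≤ M :=
    (abs_mul_cos_add_mul_sin_le b (-a) _).trans_eq (by rw [abs_neg, add_comm])
  have bc s : |c s| ≤ 1 := abs_cos_le_one _
  have bg s (hs : 0 ≤ s) : g s ≤ 1 := by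
    simp only [g, exp_le_one_iff, neg_nonpos]
    positivity
  have g0 s : 0 ≤ g s := (exp_pos _).le
  have bεw s : |ε / 16 * w s| ≤ M / 16 := by
    rw [abs_mul, abs_of_pos (by positivity : 0 < ε / 16)]
    nlinarith [bw s, abs_nonneg (w s)]
  have hr s (hs : 0 ≤ s) : |r s| ≤ ε ^ 2 * (ω ^ 2 * M) := by
    have hcw : |c s * w s| ≤ M := by
      rw [abs_mul]
      nlinarith [bc s, bw s, abs_nonneg (c s), abs_nonneg (w s)]
    have hin : |(u s + ε / 16 * w s) / 16 - 3 / 32 * w' s + c s * w s / 16| ≤ M := by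
      have := abs_le.1 (bu s)
      have := abs_le.1 (bεw s)
      have := abs_le.1 (bw' s)
      have := abs_le.1 hcw
      rw [abs_le]
      constructor <;> linarith
    have e : r s = -(ε ^ 2 * (ω ^ 2 * (g s *
        ((u s + ε / 16 * w s) / 16 - 3 / 32 * w' s + c s * w s / 16)))) := by
      simp only [r]
      ring
    rw [e, abs_neg, abs_mul, abs_mul, abs_mul, abs_of_nonneg (g0 s), abs_of_nonneg (sq_nonneg ε),
      abs_of_nonneg (sq_nonneg ω)]
    gcongr
    exact (mul_le_of_le_one_left (abs_nonneg _) (bg s hs)).trans hin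
  have henergy := perturbed_oscillator_energy_le (d := fun s => x s - y s)
    (p := fun s => v s - y' s) hω hε bc hr
    (fun s hs => (hder s hs).1.sub (hy s).hasDerivWithinAt)
    (fun s hs => ((hder s hs).2.sub (hy' s).hasDerivWithinAt).congr_deriv
      (by simp only [c]; ring)) ht
  -- The correction spoils the initial data only by `O(ε)`, so the initial energy of the error is
  -- `O(ε²)`.
  have hinit1 : (ω * (x 0 - y 0)) ^ 2 ≤ (ε * ω * M) ^ 2 := by
    have e : ω * (x 0 - y 0) = -(ε * ω * (w 0 / 16)) := by
      simp only [hx0, y, g, u, mul_zero, zero_div, neg_zero, exp_zero, cos_zero, sin_zero]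
      ring
    rw [e, neg_sq, sq_le_sq, abs_mul, abs_mul (ε * ω) M, abs_of_nonneg hM0]
    gcongr
    rw [abs_div, abs_of_pos (by norm_num : (0 : ℝ) < 16)]
    linarith [bw 0]
  have hinit2 : (v 0 - y' 0) ^ 2 ≤ (ε * ω * M) ^ 2 := by
    have e : v 0 - y' 0 = ε * ω * ((u 0 + ε / 16 * w 0) / 4 - 3 / 16 * w' 0) := by
      simp only [hv0, y', g, u', mul_zero, zero_div, neg_zero, exp_zero, cos_zero, sin_zero]
      ring
    rw [e, sq_le_sq, abs_mul, abs_mul (ε * ω) M, abs_of_nonneg hM0]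
    gcongr
    have := abs_le.1 (bu 0)
    have := abs_le.1 (bεw 0)
    have := abs_le.1 (bw' 0)
    rw [abs_le]
    constructor <;> linarith
  have hdiff : |x t - y t| ≤ √(exp ((ω + 1) * ε * t) * (2 + ω ^ 2)) * M * ε := by
    have hS : 0 ≤ exp ((ω + 1) * ε * t) * (2 + ω ^ 2) := by positivity
    have h : (ω * (x t - y t)) ^ 2 ≤
        (ω * (√(exp ((ω + 1) * ε * t) * (2 + ω ^ 2)) * M * ε)) ^ 2 := by
      calc (ω * (x t - y t)) ^ 2
          ≤ exp ((ω + 1) * ε * t) *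
            ((ω * (x 0 - y 0)) ^ 2 + (v 0 - y' 0) ^ 2 + ε ^ 2 * (ω ^ 2 * M) ^ 2) := by
            linarith [henergy, sq_nonneg (v t - y' t)]
        _ ≤ exp ((ω + 1) * ε * t) *
            ((ε * ω * M) ^ 2 + (ε * ω * M) ^ 2 + ε ^ 2 * (ω ^ 2 * M) ^ 2) := by gcongr
        _ = _ := by
            simp only [mul_pow]
            rw [sq_sqrt hS]
            ring
    have h' := abs_le_of_sq_le_sq h (by positivity)
    rw [abs_mul, abs_of_pos hω] at h'
    exact le_of_mul_le_mul_left h' hω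
  have hcorr : |g t * (ε / 16 * w t)| ≤ M * ε := by
    rw [abs_mul, abs_mul, abs_of_nonneg (g0 t), abs_of_pos (by positivity : 0 < ε / 16)]
    calc g t * (ε / 16 * |w t|) ≤ 1 * (ε / 16 * M) := by
          gcongr
          exacts [bg t ht, bw t]
      _ ≤ M * ε := by nlinarith [mul_nonneg hM0 hε.le]
  calc _ = |(x t - y t) + g t * (ε / 16 * w t)| := by
        congr 1
        simp only [y, g, u]
        ring
    _ ≤ _ := (abs_add_le _ _).trans (by linarith)

theorem corollary15 (ω θ x₀ v₀ : ℝ) (hω : 0 < ω)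
    (hθ : TanHalfEqRatio θ (x₀ - v₀ / ω) (x₀ + v₀ / ω)) (K : ℝ) (hK : 0 < K) :
    ∃ C > (0 : ℝ), ∃ ε₀ > (0 : ℝ), ∀ ε : ℝ, 0 < ε → ε < ε₀ →
      ∀ x : ℝ → ℝ, IsPhaseMathieuSolution ω ε θ x₀ v₀ x →
        ∀ t : ℝ, 0 ≤ t → t ≤ K / ε →
          |x t - Real.exp (-(ε * ω * t / 4)) *
              (x₀ * Real.cos (ω * t) + v₀ * Real.sin (ω * t) / ω)| ≤ C * ε := by
  obtain ⟨h₁, h₂⟩ := hθ.reflection_fixed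
  -- The final `+ 1` keeps the constant positive when `x₀ = v₀ = 0`.
  refine ⟨(√(Real.exp ((ω + 1) * K) * (2 + ω ^ 2)) + 1) * (|x₀| + |v₀ / ω|) + 1, by positivity,
    1, one_pos, fun ε hε hε1 x hx t ht htK => ?_⟩
  rw [← mul_div_cancel₀ v₀ hω.ne'] at hx
  have h := hx.abs_sub_le hω hε hε1 h₁ h₂ ht
  have hεt : ε * t ≤ K := by
    rw [le_div_iff₀ hε] at htK
    linarith
  rw [mul_div_right_comm v₀]
  refine h.trans (mul_le_mul_of_nonneg_right ?_ hε.le)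
  have : (√(Real.exp ((ω + 1) * ε * t) * (2 + ω ^ 2)) + 1) * (|x₀| + |v₀ / ω|) ≤
      (√(Real.exp ((ω + 1) * K) * (2 + ω ^ 2)) + 1) * (|x₀| + |v₀ / ω|) := by
    rw [mul_assoc (ω + 1)]
    gcongr
  linarith
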